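/- Let $X$ and $Y$ be real Banach spaces and let $J$ be a connected topological space. For each $s\in J$ let $\Omega(s)\colon X\times Y\to\mathbb{R}$ be a bounded bilinear form such that the bounded operators $L_{\Omega(s)}\colon X\to Y^*$, $(L_{\Omega(s)}x)(y)=\Omega(s)(x,y)$, are injective and depend continuously on $s$ in the operator norm. A linear relation $T\colon X\leadsto Y$ is a linear subspace $T\subset X\times Y$; put $\ker T=\{x : (x,0)\in T\}$ and $\operatorname{ran}T=\{y : (x,y)\in T\text{ for some }x\in X\}$. It is Fredholm if $T$ is closed in $X\times Y$, $\operatorname{ran}T$ is closed in $Y$, and $\dim\ker T$ and $\dim Y/\operatorname{ran}T$ are finite; its index is then $\dim\ker T-\dim Y/\operatorname{ran}T$. It is skew-adjoint with respect to a bilinear form $\Omega$ on $X\times Y$ if $$\{(x,-y) : (x,y)\in T\}=\{(x_2,y_2)\in X\times Y : \Omega(x_1,y_2)-\Omega(x_2,y_1)=0\text{ for all }(x_1,y_1)\in T\}.$$ Let $\{T(s)\colon X\leadsto Y\}_{s\in J}$ be a family of Fredholm linear relations of index $0$ which is continuous in the gap topology on the closed linear subspaces of $X\times Y$, that is, for each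 $s\in J$ one has $\max\{\delta(T(t),T(s)),\delta(T(s),T(t))\}\to 0$ as $t\to s$, where $\delta(M,N)=\sup\{\operatorname{dist}(u,N) : u\in M,\ \|u\|=1\}$ (and $\delta(\{0\},N)=0$). Assume that $T(s)$ is skew-adjoint with respect to $\Omega(s)$ for each $s\in J$. Then $\dim\ker T(s)\bmod 2\in\mathbb{Z}_2$ is constant for $s\in J$. -/

import Mathlib

open Filter Topology

/-- A linear relation `X ⇝ Y` between real vector spaces: a linear subspace of `X × Y`. -/
abbrev LinRel (X Y : Type*) [AddCommGroup X] [Module ℝ X] [AddCommGroup Y] [Module ℝ Y] :=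
  Submodule ℝ (X × Y)

namespace LinRel

section Algebra

variable {X Y : Type*} [AddCommGroup X] [Module ℝ X] [AddCommGroup Y] [Module ℝ Y]

/-- The kernel `{x | (x, 0) ∈ T}` of a linear relation. -/
def ker (T : LinRel X Y) : Submodule ℝ X := Submodule.comap (LinearMap.inl ℝ X Y) T

/-- The range `{y | ∃ x, (x, y) ∈ T}` of a linear relation. -/
def ran (T : LinRel X Y) : Submodule ℝ Y := Submodule.map (LinearMap.snd ℝ X Y) T

/-- The relation `h ∘ T = {(x, h y) | (x, y) ∈ T}`. -/
def scale (h : ℝ) (T : LinRel X Y) : LinRel X Y :=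
  Submodule.map (LinearMap.prodMap LinearMap.id (h • LinearMap.id)) T

/-- The index `dim ker T - dim Y / ran T` (meaningful when both dimensions are finite). -/
noncomputable def index (T : LinRel X Y) : ℤ :=
  (Module.finrank ℝ T.ker : ℤ) - (Module.finrank ℝ (Y ⧸ T.ran) : ℤ)

end Algebra

section Normed

variable {X Y : Type*} [NormedAddCommGroup X] [NormedSpace ℝ X]
  [NormedAddCommGroup Y] [NormedSpace ℝ Y]

/-- The form `ω((x₁, y₁), (x₂, y₂)) = Ω(x₁, y₂) - Ω(x₂, y₁)` on `X × Y` associated with a bounded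
bilinear form `Ω` on `X × Y`. The form `Ω` is given as the bounded operator
`L_Ω : X → Y*`, `(L_Ω x) y = Ω(x, y)`. -/
noncomputable def assocForm (Ω : X →L[ℝ] StrongDual ℝ Y) (u v : X × Y) : ℝ :=
  Ω u.1 v.2 - Ω v.1 u.2

/-- The `Ω`-adjoint of a relation `T`: its annihilator with respect to the associated form. -/
noncomputable def adjoint (Ω : X →L[ℝ] StrongDual ℝ Y) (T : LinRel X Y) : LinRel X Y where
  carrier := {v | ∀ u ∈ T, assocForm Ω u v = 0}
  zero_mem' := by
    intro u _
    simp [assocForm]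
  add_mem' := by
    intro a b ha hb u hu
    have h1 := ha u hu
    have h2 := hb u hu
    simp only [assocForm, Prod.fst_add, Prod.snd_add, map_add, add_apply] at *
    linarith
  smul_mem' := by
    intro c a ha u hu
    have h1 := ha u hu
    simp only [assocForm, Prod.smul_fst, Prod.smul_snd, map_smul, smul_apply, smul_eq_mul] at *
    rw [← mul_sub, h1, mul_zero]

/-- `T` is skew-adjoint with respect to `Ω`: `(-1) ∘ T` is equal to the `Ω`-adjoint of `T`. -/
def IsSkewAdjoint (Ω : X →L[ℝ] StrongDual ℝ Y) (T : LinRel X Y) : Prop :=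
  scale (-1) T = adjoint Ω T

/-- Fredholm linear relations: closed, with finite-dimensional kernel and closed range of finite
codimension. -/
structure IsFredholm (T : LinRel X Y) : Prop where
  isClosed : IsClosed (T : Set (X × Y))
  finiteDimensional_ker : FiniteDimensional ℝ T.ker
  isClosed_ran : IsClosed (T.ran : Set Y)
  finiteDimensional_coker : FiniteDimensional ℝ (Y ⧸ T.ran)

end Normed

end LinRel

section Gap

variable {Z : Type*} [NormedAddCommGroup Z] [NormedSpace ℝ Z]

/-- `δ(M, N)`: the supremum of `dist(u, N)` over the unit sphere of `M`; it is `0` for `M = 0`,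
the supremum of the empty set of real numbers being `0` here. -/
noncomputable def gapDelta (M N : Submodule ℝ Z) : ℝ :=
  sSup ((fun u : Z => Metric.infDist u (N : Set Z)) '' {u : Z | u ∈ M ∧ ‖u‖ = 1})

/-- The gap between two linear subspaces. -/
noncomputable def gap (M N : Submodule ℝ Z) : ℝ := max (gapDelta M N) (gapDelta N M)

/-- Continuity, for the gap topology, of a family of closed subspaces: at each parameter `s`, the
gap between `M t` and `M s` tends to `0` as `t` tends to `s`. -/
def GapContinuous {J : Type*} [TopologicalSpace J] (M : J → Submodule ℝ Z) : Prop :=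
  ∀ s : J, Tendsto (fun t => gap (M t) (M s)) (𝓝 s) (𝓝 0)

end Gap

/-! ### Stability of bijectivity under small gap. -/

section GapPerturbation

variable {Z V : Type*} [NormedAddCommGroup Z] [NormedSpace ℝ Z]
  [NormedAddCommGroup V] [NormedSpace ℝ V]

/-! The parity is locally constant, by a finite-dimensional reduction. Fix `s` and a
finite-dimensional complement `C` of `ran T(s)`. The map `(x, y) ↦ (Ω(x, ·)|_C, y mod C)` sends
`T(s)` bijectively onto `C* × Y/C` (`bijective_reduction_of_isCompl_ran`), and with the same `C`
this persists for `t` near `s` (`exists_bijective_of_gap_lt`).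

Whenever it holds, `N = {(x, y) ∈ T : y ∈ C}` is isomorphic to `C*`, and `Ω(x₁, y₂)` is a skew form
on `N` with radical `ker T`. Skew forms have even rank, so `dim ker T ≡ dim C` mod 2, at `t` as at
`s`. -/

theorem infDist_le_gapDelta (M N : Submodule ℝ Z) {u : Z} (hu : u ∈ M) (h1 : ‖u‖ = 1) :
    Metric.infDist u (N : Set Z) ≤ gapDelta M N := by
  refine le_csSup ⟨1, ?_⟩ ⟨u, ⟨hu, h1⟩, rfl⟩
  rintro _ ⟨v, ⟨-, hv⟩, rfl⟩
  have := Metric.infDist_le_dist_of_mem (x := v) N.zero_mem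
  rwa [dist_zero_right, hv] at this

theorem exists_norm_sub_le_of_gapDelta_lt {M N : Submodule ℝ Z} {ε : ℝ}
    (h : gapDelta M N < ε) {u : Z} (hu : u ∈ M) : ∃ v ∈ N, ‖u - v‖ ≤ ε * ‖u‖ := by
  rcases eq_or_ne u 0 with rfl | hu0
  · exact ⟨0, N.zero_mem, by simp⟩
  have hpos : 0 < ‖u‖ := norm_pos_iff.2 hu0
  have hd : Metric.infDist (‖u‖⁻¹ • u) (N : Set Z) < ε :=
    (infDist_le_gapDelta M N (M.smul_mem _ hu) (norm_smul_inv_norm (𝕜 := ℝ) hu0)).trans_lt h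
  obtain ⟨v, hv, hv'⟩ := (Metric.infDist_lt_iff ⟨0, N.zero_mem⟩).1 hd
  refine ⟨‖u‖ • v, N.smul_mem _ hv, ?_⟩
  have : u - ‖u‖ • v = ‖u‖ • (‖u‖⁻¹ • u - v) := by
    rw [smul_sub, smul_inv_smul₀ hpos.ne']
  rw [this, norm_smul, norm_norm, mul_comm, ← dist_eq_norm]
  exact mul_le_mul_of_nonneg_right hv'.le hpos.le

/-- A bounded operator which is bijective from a closed subspace `M₀` onto a Banach space stays
bijective under small perturbations of the operator and gap-small perturbations of `M₀`. -/
theorem exists_bijective_of_gap_lt [CompleteSpace Z] [CompleteSpace V] {F₀ : Z →L[ℝ] V}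
    {M₀ : Submodule ℝ Z} (hM₀ : IsClosed (M₀ : Set Z))
    (hF₀ : Function.Bijective (F₀.comp M₀.subtypeL)) :
    ∃ ε > 0, ∀ (F : Z →L[ℝ] V) (M : Submodule ℝ Z), IsClosed (M : Set Z) → ‖F - F₀‖ < ε →
      gap M M₀ < ε → Function.Bijective (F.comp M.subtypeL) := by
  have : CompleteSpace M₀ := hM₀.completeSpace_coe
  let e : M₀ ≃L[ℝ] V := ContinuousLinearEquiv.ofBijective (F₀.comp M₀.subtypeL)
    (LinearMap.ker_eq_bot.2 hF₀.1) (LinearMap.range_eq_top.2 hF₀.2)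
  have he : ∀ u : M₀, e u = F₀ u := fun u => rfl
  obtain ⟨C, hC1, hC⟩ : ∃ C : ℝ, 1 ≤ C ∧ ∀ v, ‖e.symm v‖ ≤ C * ‖v‖ :=
    ⟨max 1 ‖(e.symm : V →L[ℝ] M₀)‖, le_max_left _ _, fun v =>
      ((e.symm : V →L[ℝ] M₀).le_opNorm v).trans
        (mul_le_mul_of_nonneg_right (le_max_right _ _) (norm_nonneg _))⟩
  -- In `hclose`, replacing `F` by `F₀` costs `2εr` and moving `u` to `u₀` costs `‖F₀‖εr`. The
  -- choice of `ε` makes this error, after applying the inverse (bounded by `C`), at most a quarter.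
  set B : ℝ := ‖F₀‖ + 2 with hB
  have hB2 : 2 ≤ B := by have := norm_nonneg F₀; linarith
  have hden : 0 < 4 * C * B := by positivity
  set ε : ℝ := 1 / (4 * C * B) with hε
  have hεpos : 0 < ε := by positivity
  have hεCB : C * (B * ε) = 1 / 4 := by rw [hε]; field_simp
  have hε1 : ε ≤ 1 / 4 := by
    nlinarith [mul_le_mul hC1 hB2 (by norm_num) (by linarith : (0 : ℝ) ≤ C)]
  refine ⟨ε, hεpos, fun F M hM hF hgap => ?_⟩
  have h1 : gapDelta M M₀ < ε := (le_max_left _ _).trans_lt hgap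
  have h2 : gapDelta M₀ M < ε := (le_max_right _ _).trans_lt hgap
  have hclose : ∀ u u₀ : Z, ∀ r : ℝ, ‖u‖ ≤ 2 * r → ‖u - u₀‖ ≤ ε * r → 0 ≤ r →
      ‖F u - F₀ u₀‖ ≤ B * ε * r := by
    intro u u₀ r hu huu hr
    have : F u - F₀ u₀ = (F - F₀) u + F₀ (u - u₀) := by simp
    rw [this]
    calc ‖(F - F₀) u + F₀ (u - u₀)‖ ≤ ‖F - F₀‖ * ‖u‖ + ‖F₀‖ * ‖u - u₀‖ :=
          (norm_add_le _ _).trans (add_le_add ((F - F₀).le_opNorm u) (F₀.le_opNorm _))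
      _ ≤ ε * (2 * r) + ‖F₀‖ * (ε * r) := by gcongr
      _ = B * ε * r := by rw [hB]; ring
  have hbelow : ∀ u : M, ‖u‖ ≤ (2 * C) * ‖F u‖ := by
    intro u
    obtain ⟨v, hv, huv⟩ := exists_norm_sub_le_of_gapDelta_lt h1 u.2
    have hn := norm_nonneg (u : Z)
    have hc := hclose u v ‖(u : Z)‖ (by linarith) huv hn
    have hv1 := hC (e ⟨v, hv⟩)
    rw [e.symm_apply_apply, he] at hv1
    have hv1 : ‖v‖ ≤ C * ‖F₀ v‖ := hv1
    have hF₀v : ‖F₀ v‖ ≤ ‖F u‖ + B * ε * ‖(u : Z)‖ := by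
      have := norm_sub_norm_le (F₀ v) (F u)
      rw [norm_sub_rev] at this
      linarith
    have huv' := norm_sub_norm_le (u : Z) v
    have h3 : C * ‖F₀ v‖ ≤ C * ‖F u‖ + 1 / 4 * ‖(u : Z)‖ := by
      calc C * ‖F₀ v‖ ≤ C * (‖F u‖ + B * ε * ‖(u : Z)‖) := by gcongr
        _ = C * ‖F u‖ + C * (B * ε) * ‖(u : Z)‖ := by ring
        _ = _ := by rw [hεCB]
    have h4 : ε * ‖(u : Z)‖ ≤ 1 / 4 * ‖(u : Z)‖ := mul_le_mul_of_nonneg_right hε1 hn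
    have : ‖(u : Z)‖ ≤ (2 * C) * ‖F u‖ := by linarith
    simpa using this
  have : CompleteSpace M := hM.completeSpace_coe
  have hanti : AntilipschitzWith (2 * C).toNNReal (F.comp M.subtypeL) := by
    refine AddMonoidHomClass.antilipschitz_of_bound _ fun u => ?_
    rw [Real.coe_toNNReal _ (by linarith)]
    exact hbelow u
  refine ⟨hanti.injective, ?_⟩
  have hclosed : IsClosed ((F.comp M.subtypeL).range : Set V) :=
    hanti.isClosed_range (F.comp M.subtypeL).uniformContinuous
  -- A Riesz vector `v` has distance at least `‖v‖/2` from the closed range, but approximating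
  -- `e.symm v` inside `M` gives a value of `F` within `‖v‖/4` of `v`.
  by_contra hsurj
  have hex : ∃ v, v ∉ (F.comp M.subtypeL).range := by
    by_contra! h
    exact hsurj h
  obtain ⟨v, hv, hfar⟩ := riesz_lemma hclosed hex (by norm_num : (1 / 2 : ℝ) < 1)
  have hv0 : 0 < ‖v‖ := norm_pos_iff.2 fun h => hv (h ▸ zero_mem _)
  obtain ⟨u, hu, huu⟩ := exists_norm_sub_le_of_gapDelta_lt h2 (e.symm v).2
  rw [norm_sub_rev] at huu
  have hn := norm_nonneg (e.symm v : Z)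
  have hc := hclose u (e.symm v) ‖(e.symm v : Z)‖ (by
    have := norm_sub_norm_le u (e.symm v : Z)
    have h4 : ε * ‖(e.symm v : Z)‖ ≤ 1 / 4 * ‖(e.symm v : Z)‖ :=
      mul_le_mul_of_nonneg_right hε1 hn
    linarith) huu hn
  rw [← he, e.apply_symm_apply, norm_sub_rev] at hc
  have h5 := hfar (F u) ⟨⟨u, hu⟩, rfl⟩
  have h6 : B * ε * ‖(e.symm v : Z)‖ ≤ 1 / 4 * ‖v‖ := by
    calc B * ε * ‖(e.symm v : Z)‖ ≤ B * ε * (C * ‖v‖) := by gcongr; exact hC v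
      _ = C * (B * ε) * ‖v‖ := by ring
      _ = _ := by rw [hεCB]
  linarith

end GapPerturbation

/-! ### Parity of the rank of a skew form. -/

section SkewForms

/-- In odd dimension a skew matrix satisfies `det A = det Aᵀ = -det A`, hence is singular. -/
theorem even_finrank_of_skew_of_separating {V : Type*} [AddCommGroup V] [Module ℝ V]
    [FiniteDimensional ℝ V] (β : V →ₗ[ℝ] V →ₗ[ℝ] ℝ) (hskew : ∀ u v, β u v = -β v u)
    (hsep : ∀ v, (∀ u, β u v = 0) → v = 0) : Even (Module.finrank ℝ V) := by
  let b := Module.finBasis ℝ V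
  have hdet : (LinearMap.toMatrix₂ b b β).det ≠ 0 := by
    rw [← LinearMap.separatingRight_iff_det_ne_zero]
    exact hsep
  have htr : (LinearMap.toMatrix₂ b b β).transpose = -LinearMap.toMatrix₂ b b β := by
    ext i j
    simp [LinearMap.toMatrix₂_apply, hskew (b j) (b i)]
  by_contra hodd
  rw [Nat.not_even_iff_odd] at hodd
  have h := congrArg Matrix.det htr
  rw [Matrix.det_transpose, Matrix.det_neg, Fintype.card_fin, hodd.neg_one_pow] at h
  exact hdet (by linarith)

/-- The form is nondegenerate on any complement of its radical `K`, so that complement has even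
dimension. -/
theorem finrank_zmod_two_eq_of_skew {V : Type*} [AddCommGroup V] [Module ℝ V]
    [FiniteDimensional ℝ V] (β : V →ₗ[ℝ] V →ₗ[ℝ] ℝ) (hskew : ∀ u v, β u v = -β v u)
    (K : Submodule ℝ V) (hK : ∀ v, v ∈ K ↔ ∀ u, β u v = 0) :
    (Module.finrank ℝ K : ZMod 2) = Module.finrank ℝ V := by
  obtain ⟨W, hW⟩ := K.exists_isCompl
  have heven : Even (Module.finrank ℝ W) := by
    refine even_finrank_of_skew_of_separating (β.domRestrict₁₂ W W) (fun u v => hskew u v) ?_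
    intro v hv
    have hvK : (v : V) ∈ K := by
      rw [hK]
      intro u
      obtain ⟨k, hk, w, hw, rfl⟩ := Submodule.mem_sup.1
        (hW.sup_eq_top ▸ Submodule.mem_top : u ∈ K ⊔ W)
      have h1 : β k v = 0 := by rw [hskew, (hK k).1 hk, neg_zero]
      have h2 : β w v = 0 := hv ⟨w, hw⟩
      rw [map_add, LinearMap.add_apply, h1, h2, add_zero]
    exact Subtype.ext (Submodule.disjoint_def.1 hW.disjoint _ hvK v.2)
  rw [← Submodule.finrank_add_eq_of_isCompl hW, Nat.cast_add,
    (ZMod.natCast_eq_zero_iff_even).2 heven, add_zero]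

end SkewForms

/-! ### Reduction of a skew-adjoint relation to finite dimension. -/

namespace LinRel

variable {X Y : Type*} [NormedAddCommGroup X] [NormedSpace ℝ X]
  [NormedAddCommGroup Y] [NormedSpace ℝ Y]

theorem IsSkewAdjoint.add_eq_zero {Ω : X →L[ℝ] StrongDual ℝ Y} {T : LinRel X Y}
    (h : T.IsSkewAdjoint Ω) {u v : X × Y} (hu : u ∈ T) (hv : v ∈ T) :
    Ω u.1 v.2 + Ω v.1 u.2 = 0 := by
  have hv' : (v.1, -v.2) ∈ scale (-1) T := ⟨v, hv, by simp⟩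
  rw [IsSkewAdjoint] at h
  rw [h] at hv'
  have := hv' u hu
  simp only [assocForm, map_neg] at this
  linarith

/-- The operator `(x, y) ↦ (Ω(x, ·)|_C, y mod C)`. -/
noncomputable def reduction (C : Submodule ℝ Y) (Ω : X →L[ℝ] StrongDual ℝ Y) :
    X × Y →L[ℝ] StrongDual ℝ C × (Y ⧸ C) :=
  (((ContinuousLinearMap.compL ℝ C Y ℝ).flip C.subtypeL).comp
    (Ω.comp (ContinuousLinearMap.fst ℝ X Y))).prod
    (C.mkQL.comp (ContinuousLinearMap.snd ℝ X Y))

theorem continuous_reduction (C : Submodule ℝ Y) :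
    Continuous (reduction C : (X →L[ℝ] StrongDual ℝ Y) → _) := by
  have h1 : Continuous fun Ω : X →L[ℝ] StrongDual ℝ Y =>
      ((ContinuousLinearMap.compL ℝ C Y ℝ).flip C.subtypeL).comp
        (Ω.comp (ContinuousLinearMap.fst ℝ X Y)) := by fun_prop
  exact (ContinuousLinearMap.prodₗᵢ (𝕜 := ℝ) ℝ).continuous.comp
    (h1.prodMk (continuous_const (y := C.mkQL.comp (ContinuousLinearMap.snd ℝ X Y))))

theorem finrank_ker_zmod_two_of_bijective_reduction {Ω : X →L[ℝ] StrongDual ℝ Y}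
    {T : LinRel X Y} (hT : T.IsSkewAdjoint Ω) (C : Submodule ℝ Y) [FiniteDimensional ℝ C]
    (hF : Function.Bijective ((reduction C Ω).comp T.subtypeL)) :
    (Module.finrank ℝ T.ker : ZMod 2) = Module.finrank ℝ C := by
  let N : Submodule ℝ (X × Y) := T ⊓ C.comap (LinearMap.snd ℝ X Y)
  let p : N →ₗ[ℝ] StrongDual ℝ C :=
    (LinearMap.fst ℝ _ _ ∘ₗ (reduction C Ω : X × Y →ₗ[ℝ] StrongDual ℝ C × (Y ⧸ C))) ∘ₗ N.subtype
  have hpbij : Function.Bijective p := by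
    constructor
    · intro u v huv
      have h : (reduction C Ω).comp T.subtypeL ⟨u, u.2.1⟩ =
          (reduction C Ω).comp T.subtypeL ⟨v, v.2.1⟩ := by
        refine Prod.ext huv ?_
        change (Submodule.Quotient.mk (u : X × Y).2 : Y ⧸ C) = Submodule.Quotient.mk (v : X × Y).2
        exact ((Submodule.Quotient.mk_eq_zero C).2 u.2.2).trans
          ((Submodule.Quotient.mk_eq_zero C).2 v.2.2).symm
      exact Subtype.ext (congrArg (fun w : T => (w : X × Y)) (hF.1 h))
    · intro φ
      obtain ⟨u, hu⟩ := hF.2 (φ, 0)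
      have h2 : (Submodule.Quotient.mk (u : X × Y).2 : Y ⧸ C) = 0 := congrArg Prod.snd hu
      exact ⟨⟨u, u.2, (Submodule.Quotient.mk_eq_zero C).1 h2⟩, congrArg Prod.fst hu⟩
  let e : N ≃ₗ[ℝ] StrongDual ℝ C := LinearEquiv.ofBijective p hpbij
  have : FiniteDimensional ℝ N := e.symm.finiteDimensional
  have hN : Module.finrank ℝ N = Module.finrank ℝ C := by
    rw [e.finrank_eq, ← (LinearMap.toContinuousLinearMap (𝕜 := ℝ) (E := C) (F' := ℝ)).finrank_eq]
    exact Subspace.dual_finrank_eq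
  let q : N →ₗ[ℝ] C := ((LinearMap.snd ℝ X Y) ∘ₗ N.subtype).codRestrict C fun u => u.2.2
  let β : N →ₗ[ℝ] N →ₗ[ℝ] ℝ := LinearMap.mk₂ ℝ (fun u v => p u (q v))
    (by intros; simp) (by intros; simp) (by intros; simp) (by intros; simp)
  have hβ : ∀ u v : N, β u v = Ω (u : X × Y).1 (v : X × Y).2 := fun _ _ => rfl
  let K : Submodule ℝ N := LinearMap.ker q
  have hK : ∀ v, v ∈ K ↔ ∀ u, β u v = 0 := by
    intro v
    constructor
    · intro hv u
      change p u (q v) = 0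
      rw [LinearMap.mem_ker.1 hv, map_zero]
    · intro hv
      refine LinearMap.mem_ker.2 ?_
      -- Since `p` is onto `C*`, a nonzero `q v` would be detected by some `p u`.
      by_contra hne
      obtain ⟨φ, hφ⟩ := SeparatingDual.exists_ne_zero (R := ℝ) hne
      obtain ⟨u, rfl⟩ := hpbij.2 φ
      exact hφ (hv u)
  have hKT : Module.finrank ℝ K = Module.finrank ℝ T.ker := by
    let f : T.ker →ₗ[ℝ] N := (LinearMap.inl ℝ X Y ∘ₗ T.ker.subtype).codRestrict N
      fun x => ⟨x.2, C.zero_mem⟩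
    let g : T.ker →ₗ[ℝ] K := f.codRestrict K fun x => LinearMap.mem_ker.2 (Subtype.ext rfl)
    refine (LinearEquiv.ofBijective g ⟨?_, ?_⟩).finrank_eq.symm
    · intro x y hxy
      exact Subtype.ext (congrArg (fun w : K => ((w : N) : X × Y).1) hxy)
    · rintro ⟨⟨⟨x, y⟩, hT', hC'⟩, hq⟩
      have hy : y = 0 := congrArg Subtype.val (LinearMap.mem_ker.1 hq)
      subst hy
      exact ⟨⟨x, hT'⟩, rfl⟩
  rw [← hKT, ← hN]
  refine finrank_zmod_two_eq_of_skew β (fun u v => ?_) K hK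
  rw [hβ, hβ]
  exact eq_neg_of_add_eq_zero_left (hT.add_eq_zero u.2.1 v.2.1)

/-- For `x ∈ ker T`, skewness makes `Ω(x, ·)` vanish on `ran T`, so its restriction to `C`
determines `x`. Index zero gives `dim ker T = dim C`, so `ker T → C*` is bijective; the splitting `Y
= ran T ⊕ C` handles the `Y/C` component. -/
theorem bijective_reduction_of_isCompl_ran {Ω : X →L[ℝ] StrongDual ℝ Y}
    (hΩ : Function.Injective Ω) {T : LinRel X Y} (hfred : T.IsFredholm) (hindex : T.index = 0)
    (hT : T.IsSkewAdjoint Ω) {C : Submodule ℝ Y} (hC : IsCompl T.ran C)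
    [FiniteDimensional ℝ C] :
    Function.Bijective ((reduction C Ω).comp T.subtypeL) := by
  have := hfred.finiteDimensional_ker
  have hker : ∀ x ∈ T.ker, (∀ c : C, Ω x c = 0) → x = 0 := by
    intro x hx hxC
    refine hΩ ?_
    rw [map_zero]
    ext y
    obtain ⟨_, ⟨u, hu, rfl⟩, c, hc, rfl⟩ := Submodule.mem_sup.1
      (hC.sup_eq_top ▸ Submodule.mem_top : y ∈ T.ran ⊔ C)
    have h1 := hT.add_eq_zero (u := (x, 0)) hx hu
    simp only [map_zero, add_zero] at h1
    rw [map_add, LinearMap.snd_apply, h1, hxC ⟨c, hc⟩]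
    simp
  let p : T.ker →ₗ[ℝ] StrongDual ℝ C :=
    (LinearMap.fst ℝ _ _ ∘ₗ (reduction C Ω : X × Y →ₗ[ℝ] StrongDual ℝ C × (Y ⧸ C))) ∘ₗ
      (LinearMap.inl ℝ X Y ∘ₗ T.ker.subtype)
  have hpinj : Function.Injective p := by
    rw [injective_iff_map_eq_zero]
    intro x hx
    exact Subtype.ext (hker x x.2 fun c => DFunLike.congr_fun hx c)
  have hdim : Module.finrank ℝ T.ker = Module.finrank ℝ (StrongDual ℝ C) := by
    have h1 : Module.finrank ℝ (StrongDual ℝ C) = Module.finrank ℝ C := by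
      rw [← (LinearMap.toContinuousLinearMap (𝕜 := ℝ) (E := C) (F' := ℝ)).finrank_eq]
      exact Subspace.dual_finrank_eq
    have h2 := (Submodule.quotientEquivOfIsCompl T.ran C hC).finrank_eq
    rw [index] at hindex
    omega
  have hpsurj : Function.Surjective p :=
    (LinearMap.injective_iff_surjective_of_finrank_eq_finrank hdim).1 hpinj
  constructor
  · rw [injective_iff_map_eq_zero]
    rintro ⟨⟨x, y⟩, hu⟩ h
    have hy : y = 0 := Submodule.disjoint_def.1 hC.disjoint y ⟨(x, y), hu, rfl⟩
      ((Submodule.Quotient.mk_eq_zero C).1 (congrArg Prod.snd h))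
    subst hy
    have hx : x = 0 := hker x hu fun c => DFunLike.congr_fun (congrArg Prod.fst h) c
    subst hx
    rfl
  · rintro ⟨φ, y'⟩
    obtain ⟨y, rfl⟩ := Submodule.Quotient.mk_surjective C y'
    obtain ⟨_, ⟨u, hu, rfl⟩, c, hc, rfl⟩ := Submodule.mem_sup.1
      (hC.sup_eq_top ▸ Submodule.mem_top : y ∈ T.ran ⊔ C)
    obtain ⟨k, hk⟩ := hpsurj (φ - (reduction C Ω u).1)
    refine ⟨⟨u, hu⟩ + ⟨((k : X), 0), k.2⟩, ?_⟩
    rw [map_add]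
    refine Prod.ext ?_ ?_
    · change (reduction C Ω u).1 + p k = φ
      rw [hk, add_sub_cancel]
    · change (Submodule.Quotient.mk u.2 + Submodule.Quotient.mk 0 : Y ⧸ C) = _
      rw [← Submodule.Quotient.mk_add, Submodule.Quotient.eq]
      simpa using hc

end LinRel

theorem theoremt {X Y : Type*} [NormedAddCommGroup X] [NormedSpace ℝ X] [CompleteSpace X]
    [NormedAddCommGroup Y] [NormedSpace ℝ Y] [CompleteSpace Y]
    {J : Type*} [TopologicalSpace J] [ConnectedSpace J]
    (Ω : J → (X →L[ℝ] StrongDual ℝ Y)) (hΩ_cont : Continuous Ω)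
    (hΩ_inj : ∀ s : J, Function.Injective (Ω s))
    (T : J → LinRel X Y) (hT_cont : GapContinuous T)
    (hT_fred : ∀ s : J, (T s).IsFredholm) (hT_index : ∀ s : J, (T s).index = 0)
    (hT_skew : ∀ s : J, (T s).IsSkewAdjoint (Ω s)) :
    ∃ a : ZMod 2, ∀ s : J, (Module.finrank ℝ (T s).ker : ZMod 2) = a := by
  have hloc : IsLocallyConstant fun s => (Module.finrank ℝ (T s).ker : ZMod 2) := by
    rw [IsLocallyConstant.iff_eventually_eq]
    intro s
    have := (hT_fred s).finiteDimensional_coker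
    obtain ⟨C, hC⟩ := (T s).ran.exists_isCompl
    have : FiniteDimensional ℝ C :=
      (Submodule.quotientEquivOfIsCompl _ _ hC).finiteDimensional
    -- Closedness makes `Y ⧸ C` normed, not merely seminormed.
    have : IsClosed (C : Set Y) := C.closed_of_finiteDimensional
    have hs := LinRel.bijective_reduction_of_isCompl_ran (hΩ_inj s) (hT_fred s) (hT_index s)
      (hT_skew s) hC
    let _ : NormedAddCommGroup (StrongDual ℝ C × (Y ⧸ C)) := inferInstance
    let _ : NormedSpace ℝ (StrongDual ℝ C × (Y ⧸ C)) := inferInstance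
    obtain ⟨ε, hε, h⟩ := exists_bijective_of_gap_lt (F₀ := LinRel.reduction C (Ω s))
      (hT_fred s).isClosed hs
    have hred : Tendsto (fun t => LinRel.reduction C (Ω t)) (𝓝 s)
        (𝓝 (LinRel.reduction C (Ω s))) :=
      ((LinRel.continuous_reduction C).comp hΩ_cont).continuousAt
    filter_upwards [Metric.tendsto_nhds.1 hred ε hε, (hT_cont s).eventually (gt_mem_nhds hε)]
      with t ht hgap
    rw [dist_eq_norm] at ht
    rw [LinRel.finrank_ker_zmod_two_of_bijective_reduction (hT_skew t) C
        (h _ _ (hT_fred t).isClosed ht hgap),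
      LinRel.finrank_ker_zmod_two_of_bijective_reduction (hT_skew s) C hs]
  obtain ⟨s₀⟩ := (inferInstance : Nonempty J)
  exact ⟨_, fun s => hloc.apply_eq_of_preconnectedSpace s s₀⟩
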